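/- Let $\mathbf x=(x_1,x_2,\dots)$ and $\mathbf y=(y_1,y_2,\dots)$ be two disjoint infinite sequences of variables. For $n\ge 0$ let $$h_n(\mathbf x)=\sum_{1\le i_1\le i_2\le\dots\le i_n}x_{i_1}x_{i_2}\cdots x_{i_n}$$ be the complete homogeneous symmetric function (so $h_0=1$), and let $h_n(\mathbf x)=0$ for $n<0$. A partition is a non-increasing sequence of non-negative integers. For partitions $\lambda=(\lambda_1,\dots,\lambda_\ell)$ and $\mu=(\mu_1,\dots,\mu_\ell)$ let $$s_{\lambda/\mu}(\mathbf x)=\det\bigl(h_{\lambda_j-j-\mu_i+i}(\mathbf x)\bigr)_{1\le i,j\le\ell}$$ be the skew Schur function (it vanishes unless $\mu_i\le\lambda_i$ for all $i$). We say that $\lambda/\mu$ is a horizontal strip if $\lambda_1\ge\mu_1\ge\lambda_2\ge\mu_2\ge\cdots$. For a set $I=\{i_1<i_2<\dots<i_p\}$ of positive integers let $\lambda(I)=(i_p-p,\dots,i_2-2,i_1-1)$. For even $m$, the Pfaffian of an $m\times m$ skew-symmetric matrix $Y$ is $$\operatorname{Pf}(Y)=\sum_{\pi}(-1)^{\mathrm{cr}(\pi)}\prod_{i<j,\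 \{i,j\}\in\pi}Y_{i,j},$$ where $\pi$ runs over the perfect matchings of $[m]=\{1,\dots,m\}$ and $\mathrm{cr}(\pi)$ is the number of quadruples $i<j<k<l$ with $\{i,k\},\{j,l\}\in\pi$. **Theorem.** Let $m$ and $n$ be positive integers, where $m$ is even. Then, as formal power series in $\mathbf x$ and $\mathbf y$ over any commutative ring, $$\sum_{\substack{R\cup S=[m]\\ |R|=|S|=m/2}}(-1)^{\sum_{r\in R}(r-1)}\sum_{\substack{I,J\subseteq[n],\ |I|=|J|=m/2\\ \lambda(J)/\lambda(I)\text{ horizontal strip}}}s_{\lambda(I)/\lambda(R)}(\mathbf x)\,s_{\lambda(J)/\lambda(S)}(\mathbf y)$$ $$=\operatorname{Pf}\Bigl(\sum_{1\le k\le l\le n}\bigl(h_{k-i}(\mathbf x)h_{l-j}(\mathbf y)-h_{l-i}(\mathbf y)h_{k-j}(\mathbf x)\bigr)\Bigr)_{1\le i,j\le m}.$$ -/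

import Mathlib

open Finset

namespace SkewCauchy

/-- The complete homogeneous symmetric function `h_n` in the infinite sequence of variables
`x 0, x 1, x 2, …` (a sequence of distinct variables of the power series ring `R⟦σ⟧`), i.e. the
formal power series `∑_{i_1 ≤ i_2 ≤ ⋯ ≤ i_n} x_{i_1} x_{i_2} ⋯ x_{i_n}`: the coefficient of a
monomial `d` is the number of weakly increasing index sequences whose monomial is `d`.
As usual, `h_n = 0` for negative `n`. -/
noncomputable def completeHomog (R : Type*) [CommRing R] {σ : Type*} (x : ℕ ↪ σ) (n : ℤ) :
    MvPowerSeries σ R :=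
  fun d =>
    if 0 ≤ n then
      (Nat.card {i : Fin n.toNat →o ℕ // ∑ k, Finsupp.single (x (i k)) 1 = d} : R)
    else 0

/-- A partition, as a non-increasing sequence `(λ_1, …, λ_ℓ)` of non-negative integers
(the entry `λ_k` is `parts (k - 1)`). -/
structure IntPartition (ℓ : ℕ) where
  parts : Fin ℓ → ℕ
  anti : Antitone parts

/-- The skew Schur function `s_{λ/μ}(x) = det (h_{λ_j - j - μ_i + i}(x))_{1 ≤ i, j ≤ ℓ}`.
(This determinant vanishes unless `μ_i ≤ λ_i` for all `i`.) -/
noncomputable def skewSchur (R : Type*) [CommRing R] {σ : Type*} (x : ℕ ↪ σ) {ℓ : ℕ}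
    (lam mu : IntPartition ℓ) : MvPowerSeries σ R :=
  Matrix.det (Matrix.of fun i j : Fin ℓ =>
    completeHomog R x
      ((lam.parts j : ℤ) - ((j : ℕ) : ℤ) - (mu.parts i : ℤ) + ((i : ℕ) : ℤ)))

/-- `λ/μ` is a horizontal strip: `λ_1 ≥ μ_1 ≥ λ_2 ≥ μ_2 ≥ ⋯`. -/
def IsHorizontalStrip {ℓ : ℕ} (lam mu : IntPartition ℓ) : Prop :=
  (∀ k, mu.parts k ≤ lam.parts k) ∧
    ∀ k l : Fin ℓ, (k : ℕ) + 1 = (l : ℕ) → lam.parts l ≤ mu.parts k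

instance {ℓ : ℕ} (lam mu : IntPartition ℓ) : Decidable (IsHorizontalStrip lam mu) := by
  unfold IsHorizontalStrip
  infer_instance

/-- The subsets of `[n]` with exactly `p` elements; here `[n] = {1, …, n}` is represented by
`Fin n`, the element `i` of `[n]` being the element of `Fin n` with value `i - 1`. -/
abbrev SubsetOfCard (n p : ℕ) : Type := {I : Finset (Fin n) // I.card = p}

/-- The elements `i_1 < i_2 < ⋯ < i_p` of a `p`-subset satisfy `i_k ≥ k`, and the differences
`i_k - k` are weakly increasing. -/
theorem monotone_sub {n p : ℕ} (I : SubsetOfCard n p) :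
    (∀ k : Fin p, (k : ℕ) ≤ (I.1.orderEmbOfFin I.2 k : ℕ)) ∧
      Monotone fun k : Fin p => (I.1.orderEmbOfFin I.2 k : ℕ) - (k : ℕ) := by
  have key : ∀ (d : ℕ) (a b : Fin p), (a : ℕ) + d = b →
      (I.1.orderEmbOfFin I.2 a : ℕ) + d ≤ (I.1.orderEmbOfFin I.2 b : ℕ) := by
    intro d
    induction d with
    | zero =>
      intro a b h
      have : a = b := Fin.ext (by omega)
      subst this
      simp
    | succ d ih =>
      intro a b h
      have hb := b.isLt
      let c : Fin p := ⟨(a : ℕ) + d, by omega⟩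
      have h1 := ih a c rfl
      have hcb : c < b := by
        rw [Fin.lt_def]
        change (a : ℕ) + d < b
        omega
      have h2 : (I.1.orderEmbOfFin I.2 c : ℕ) < (I.1.orderEmbOfFin I.2 b : ℕ) :=
        Fin.lt_def.1 ((I.1.orderEmbOfFin I.2).strictMono hcb)
      omega
  have hge : ∀ k : Fin p, (k : ℕ) ≤ (I.1.orderEmbOfFin I.2 k : ℕ) := by
    intro k
    have hk := k.isLt
    have := key k ⟨0, by omega⟩ k (by simp)
    omega
  refine ⟨hge, ?_⟩
  intro a b hab
  have hab' : (a : ℕ) ≤ b := hab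
  have h := key ((b : ℕ) - a) a b (by omega)
  have ha := hge a
  change (I.1.orderEmbOfFin I.2 a : ℕ) - (a : ℕ) ≤ (I.1.orderEmbOfFin I.2 b : ℕ) - (b : ℕ)
  omega

/-- For `I = {i_1 < i_2 < ⋯ < i_p}`, the partition `λ(I) = (i_p - p, …, i_2 - 2, i_1 - 1)`.
(The differences do not change when elements and positions are both counted from `0`.) -/
def lam {n p : ℕ} (I : SubsetOfCard n p) : IntPartition p where
  parts k := (I.1.orderEmbOfFin I.2 k.rev : ℕ) - (k.rev : ℕ)
  anti := fun _ _ h => (monotone_sub I).2 (Fin.rev_le_rev.2 h)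

/-- Perfect matchings of `[m]`, a matching being encoded by the fixed-point-free involution
that sends every point to its partner. -/
abbrev PerfectMatching (m : ℕ) : Type :=
  {μ : Equiv.Perm (Fin m) // ∀ i, μ (μ i) = i ∧ μ i ≠ i}

/-- The number of crossings of a perfect matching: the number of quadruples `i < j < k < l`
such that `{i, k}` and `{j, l}` are pairs of the matching (here `k = μ i` and `l = μ j`). -/
def crossings {m : ℕ} (μ : PerfectMatching m) : ℕ :=
  #{q : Fin m × Fin m | q.1 < q.2 ∧ q.2 < μ.1 q.1 ∧ μ.1 q.1 < μ.1 q.2}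

/-- The Pfaffian `Pf(Y) = ∑_μ (-1)^{cr(μ)} ∏_{i < j, {i, j} ∈ μ} Y_{i, j}`, the sum being over
all perfect matchings. -/
def pfaffian {A : Type*} [CommRing A] {m : ℕ} (Y : Matrix (Fin m) (Fin m) A) : A :=
  ∑ μ : PerfectMatching m, (-1) ^ crossings μ * ∏ i with i < μ.1 i, Y i (μ.1 i)

/-- The sequence `x` of variables among two disjoint sequences of variables. -/
abbrev xVars : ℕ ↪ ℕ ⊕ ℕ := Function.Embedding.inl

/-- The sequence `y` of variables among two disjoint sequences of variables. -/
abbrev yVars : ℕ ↪ ℕ ⊕ ℕ := Function.Embedding.inr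

end SkewCauchy

/-!
The identity has nothing to do with symmetric functions as such: it holds for arbitrary `m × n`
matrices `X`, `Y` over a commutative ring in place of `(h_{k-i}(x))` and `(h_{l-j}(y))`.

* Reading rows and columns in the reverse order, the skew Schur function `s_{λ(I)/λ(R)}` is the
  minor of `X` with rows `R` and columns `I` (`skewSchur_lam_eq_det`).
* With `T` the matrix `([k ≤ l])`, the matrix on the right-hand side is `B - Bᵀ` for `B = X T Yᵀ`.
  The Pfaffian of any `B - Bᵀ` is a signed sum of the minors of `B` whose rows `R` and columns `S`
  are complementary (`pfaffian_sub_transpose`): expanding the products orients every pair of a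
  matching, `R` collects the sources, and the oriented matchings with source set `R` are the
  bijections `R → S`, i.e. the terms of that minor. The signs agree because of a parity identity
  that can be checked on two pairs of the matching at a time (`chord_parity`).
* Two applications of the Cauchy–Binet formula (`det_mul_eq_sum_minors`) split a minor of `X T Yᵀ`
  into minors of `X`, `T` and `Y`. The minor of `T` with rows `I` and columns `J` is `1` if
  `i₁ ≤ j₁ < i₂ ≤ j₂ < ⋯` and `0` otherwise (`det_le_indicator_eq`), and this interlacing says that
  `λ(J)/λ(I)` is a horizontal strip (`isHorizontalStrip_lam_iff`).
-/

namespace SkewCauchy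

/-! ### The Cauchy–Binet formula -/

section Minors

variable {A : Type*} [CommRing A] {n p : ℕ}

theorem exists_perm_orderEmbOfFin {α : Type*} [LinearOrder α] (s : Finset α) (hs : #s = p)
    {f : Fin p → α} (hf : Function.Injective f) (hfs : ∀ a, f a ∈ s) :
    ∃ τ : Equiv.Perm (Fin p), ∀ a, f a = s.orderEmbOfFin hs (τ a) := by
  have h : ∀ a, ∃ b, s.orderEmbOfFin hs b = f a := fun a => by
    have : f a ∈ Set.range (s.orderEmbOfFin hs) := by
      rw [range_orderEmbOfFin]; exact hfs a
    exact this
  choose g hg using h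
  have hginj : Function.Injective g := fun a b hab => hf (by rw [← hg a, ← hg b, hab])
  exact ⟨Equiv.ofBijective g (Finite.injective_iff_bijective.1 hginj), fun a => (hg a).symm⟩

/-- An injective `f : Fin p → Fin n` is determined by its range and the order in which it runs
through it. -/
theorem sum_eq_sum_subset_sum_perm (F : (Fin p → Fin n) → A)
    (hF : ∀ f, ¬ Function.Injective f → F f = 0) :
    ∑ f, F f = ∑ I : SubsetOfCard n p, ∑ τ : Equiv.Perm (Fin p),
      F fun a => I.1.orderEmbOfFin I.2 (τ a) := by
  rw [← Fintype.sum_prod_type']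
  symm
  refine Finset.sum_of_injOn
    (fun q : SubsetOfCard n p × Equiv.Perm (Fin p) => fun a => q.1.1.orderEmbOfFin q.1.2 (q.2 a))
    ?_ (by simp) ?_ (fun _ _ => rfl)
  · rintro ⟨⟨I, hI⟩, τ⟩ - ⟨⟨J, hJ⟩, υ⟩ - h
    have him : ∀ (K : Finset (Fin n)) (hK : #K = p) (σ : Equiv.Perm (Fin p)),
        univ.image (fun a => K.orderEmbOfFin hK (σ a)) = K := fun K hK σ => by
      have := Finset.image_image (s := univ) (f := σ) (g := K.orderEmbOfFin hK)
      rw [Finset.image_univ_equiv, image_orderEmbOfFin_univ] at this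
      exact this.symm
    have hIJ : I = J := by
      rw [← him I hI τ, ← him J hJ υ]
      exact congrArg (fun f => univ.image f) h
    subst hIJ
    have : τ = υ := Equiv.ext fun a => (I.orderEmbOfFin hI).injective (congrFun h a)
    rw [this]
  · intro f _ hf
    apply hF
    intro hinj
    apply hf
    have hc : #(univ.image f) = p := by
      rw [card_image_of_injective _ hinj, card_univ, Fintype.card_fin]
    obtain ⟨τ, hτ⟩ := exists_perm_orderEmbOfFin (univ.image f) hc hinj (by simp)
    exact ⟨(⟨univ.image f, hc⟩, τ), by simp, funext fun a => (hτ a).symm⟩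

/-- The Cauchy–Binet formula. -/
theorem det_mul_eq_sum_minors (M : Matrix (Fin p) (Fin n) A) (N : Matrix (Fin n) (Fin p) A) :
    (M * N).det = ∑ I : SubsetOfCard n p,
      (M.submatrix id (I.1.orderEmbOfFin I.2)).det *
        (N.submatrix (I.1.orderEmbOfFin I.2) id).det := by
  have h1 : (M * N).det = ∑ f : Fin p → Fin n, (∏ a, M a (f a)) * (N.submatrix f id).det := by
    have hrow : M * N = fun a => ∑ k, M a k • N k := by
      ext a b
      simp [Matrix.mul_apply]
    have := (Matrix.detRowAlternating (n := Fin p) (R := A)).toMultilinearMap.map_sum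
      (fun a k => M a k • N k)
    rw [hrow]
    refine this.trans (Finset.sum_congr rfl fun f _ => ?_)
    exact (Matrix.detRowAlternating (n := Fin p) (R := A)).toMultilinearMap.map_smul_univ
      (fun a => M a (f a)) (fun a => N (f a))
  rw [h1, sum_eq_sum_subset_sum_perm]
  · refine Finset.sum_congr rfl fun I _ => ?_
    rw [← Matrix.det_transpose (M.submatrix id _), Matrix.det_apply', Finset.sum_mul]
    refine Finset.sum_congr rfl fun τ _ => ?_
    have : N.submatrix (fun a => I.1.orderEmbOfFin I.2 (τ a)) id =
        (N.submatrix (I.1.orderEmbOfFin I.2) id).submatrix τ id := rfl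
    rw [this, Matrix.det_permute]
    simp only [Matrix.transpose_apply, Matrix.submatrix_apply, id]
    ring
  · intro f hf
    simp only [Function.Injective, not_forall] at hf
    obtain ⟨a, b, hab, hne⟩ := hf
    rw [Matrix.det_zero_of_row_eq hne, mul_zero]
    ext c
    simp [hab]

end Minors

/-! ### Minors of the matrix of the order relation -/

section Interlacing

variable {A : Type*} [CommRing A] {p : ℕ}

/-- The minors of the matrix `([x ≤ y])` are `1` or `0`. If the sequences interlace, the minor is
unitriangular. Otherwise it has a zero row or two equal rows: each row is the indicator of a final
segment of the columns, and these segments shrink from row to row, so if they are nonempty and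
distinct they start on the diagonal, which is interlacing. -/
theorem det_le_indicator_eq {α : Type*} [LinearOrder α] {u v : Fin p → α} (hu : StrictMono u)
    (hv : StrictMono v) [Decidable ((∀ k, u k ≤ v k) ∧ ∀ k l : Fin p, (k : ℕ) + 1 = l → v k < u l)] :
    (Matrix.of fun a b => if u a ≤ v b then (1 : A) else 0).det =
      if (∀ k, u k ≤ v k) ∧ ∀ k l : Fin p, (k : ℕ) + 1 = l → v k < u l then 1 else 0 := by
  split_ifs with h
  · obtain ⟨h1, h2⟩ := h
    rw [Matrix.det_of_isUpperTriangular]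
    · simp [h1]
    · intro a b hab
      have hab : b < a := hab
      have hlt : (b : ℕ) < a := hab
      have hva : v b < u a :=
        (h2 b ⟨b + 1, by omega⟩ rfl).trans_le (hu.monotone (Fin.le_def.2 hlt))
      simp [hva]
  · by_contra hdet
    apply h
    -- `c a` is the first column in which row `a` has a nonzero entry.
    have hex : ∀ a, ∃ b, u a ≤ v b := by
      intro a
      by_contra hno
      push Not at hno
      exact hdet (Matrix.det_eq_zero_of_row_eq_zero a fun b => by simp [hno b])
    have hc : ∀ a, ∃ c, ∀ b, u a ≤ v b ↔ c ≤ b := by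
      intro a
      obtain ⟨c, hc1, hc2⟩ := WellFounded.has_min wellFounded_lt {b | u a ≤ v b} (hex a)
      exact ⟨c, fun b => ⟨fun hb => not_lt.1 (hc2 b hb),
        fun hb => le_trans hc1 (hv.monotone hb)⟩⟩
    choose c hc using hc
    have hinj : Function.Injective c := by
      intro a a' haa
      by_contra hne
      refine hdet (Matrix.det_zero_of_row_eq hne ?_)
      ext b
      simp [hc, haa]
    have hmono : Monotone c := fun a a' haa =>
      (hc a _).1 ((hu.monotone haa).trans ((hc a' _).2 le_rfl))
    have hid : c = id := by
      have h0 : Set.range c = Set.range (id : Fin p → Fin p) := by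
        rw [(Finite.injective_iff_surjective.1 hinj).range_eq, Set.range_id]
      exact (StrictMono.range_inj (hmono.strictMono_of_injective hinj) strictMono_id).1 h0
    simp only [hid, id] at hc
    refine ⟨fun k => (hc k k).2 le_rfl, fun k l hkl => ?_⟩
    rw [← not_le, hc, not_le, Fin.lt_def]
    omega

end Interlacing

/-! ### The sign of an oriented perfect matching -/

section Signs

variable {m p : ℕ}

theorem sign_eq_neg_one_pow_inversions (τ : Equiv.Perm (Fin p)) :
    Equiv.Perm.sign τ = (-1) ^ ∑ a, ∑ b, if a < b ∧ τ b < τ a then 1 else 0 := by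
  rw [Equiv.Perm.sign_eq_prod_prod_Ioi, ← Finset.prod_pow_eq_pow_sum]
  refine Finset.prod_congr rfl fun a _ => ?_
  rw [← Finset.prod_pow_eq_pow_sum, ← Finset.filter_lt_eq_Ioi, Finset.prod_filter]
  refine Finset.prod_congr rfl fun b _ => ?_
  by_cases hab : a < b
  · have hne : τ a ≠ τ b := fun h => hab.ne (τ.injective h)
    rcases lt_or_gt_of_ne hne with h | h
    · simp [hab, h, h.not_gt]
    · simp [hab, h, h.not_gt]
  · simp [hab]

/-- The indicator, in `ZMod 2`, of `i < j < i' < j'`: the pairs `{i, i'}` and `{j, j'}` cross,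
with all four points in this order. -/
def crossInd {α : Type*} [LinearOrder α] (i i' j j' : α) : ZMod 2 :=
  if i < j ∧ j < i' ∧ i' < j' then 1 else 0

/-- The contribution of the ordered pair of oriented chords `r → s` and `r' → s'` to the sum modulo
`2` of the number of crossings, the number of inversions of `s` against `r`, and the number of
points to the left of the sources (whose total is the sum of the sources, counted from `0`). -/
def chordWeight {α : Type*} [LinearOrder α] (r s r' s' : α) : ZMod 2 :=
  (crossInd r s r' s' + crossInd r s s' r' + crossInd s r r' s' + crossInd s r s' r') +
    (if r < r' ∧ s' < s then 1 else 0) + ((if r' < r then 1 else 0) + if s' < r then 1 else 0)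

/-- The contributions of two distinct chords cancel modulo `2`, in each of the `24` relative orders
of their endpoints. -/
theorem chord_parity {α : Type*} [LinearOrder α] {r s r' s' : α} (h1 : r ≠ s) (h2 : r ≠ r')
    (h3 : r ≠ s') (h4 : s ≠ r') (h5 : s ≠ s') (h6 : r' ≠ s') :
    chordWeight r s r' s' + chordWeight r' s' r s = 0 := by
  have key : ∀ {x y : α}, x ≠ y → (x < y ∧ ¬ y < x) ∨ (y < x ∧ ¬ x < y) := fun h =>
    (lt_or_gt_of_ne h).imp (fun h => ⟨h, h.not_gt⟩) (fun h => ⟨h, h.not_gt⟩)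
  unfold chordWeight crossInd
  rcases key h1 with ⟨a1, b1⟩ | ⟨a1, b1⟩ <;> rcases key h2 with ⟨a2, b2⟩ | ⟨a2, b2⟩ <;>
  rcases key h3 with ⟨a3, b3⟩ | ⟨a3, b3⟩ <;> rcases key h4 with ⟨a4, b4⟩ | ⟨a4, b4⟩ <;>
  rcases key h5 with ⟨a5, b5⟩ | ⟨a5, b5⟩ <;> rcases key h6 with ⟨a6, b6⟩ | ⟨a6, b6⟩ <;>
  first
  | (exfalso; order)
  | (simp only [*, and_true, and_false, if_true, if_false]
     decide)

theorem sum_eq_sum_sources_add_targets {M : Type*} [AddCommMonoid M] {r s : Fin p → Fin m}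
    (hrs : Function.Bijective (Sum.elim r s)) (f : Fin m → M) :
    ∑ i, f i = ∑ a, (f (r a) + f (s a)) := by
  rw [← (Equiv.ofBijective _ hrs).sum_comp f, Fintype.sum_sum_type, ← Finset.sum_add_distrib]
  rfl

/-- The two sides differ by the sum of `chordWeight` over all ordered pairs of distinct oriented
chords `r a → t a`, while the terms coming from a single chord cancel on their own. -/
theorem crossings_parity (μ : PerfectMatching m) (τ : Equiv.Perm (Fin p)) {r s t : Fin p → Fin m}
    (hr : StrictMono r) (hs : StrictMono s) (hrs : Function.Bijective (Sum.elim r s))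
    (ht : ∀ a, t a = s (τ a)) (hμ : ∀ a, μ.1 (r a) = t a) :
    ((crossings μ + #{a | μ.1 (r a) < r a} : ℕ) : ZMod 2) =
      ((∑ a, (r a : ℕ) + ∑ a, ∑ b, if a < b ∧ τ b < τ a then 1 else 0 : ℕ) : ZMod 2) := by
  have hrt : Function.Bijective (Sum.elim r t) := by
    have : Sum.elim r t = Sum.elim r s ∘ Equiv.sumCongr (Equiv.refl _) τ := by
      ext x; rcases x with x | x <;> simp [ht]
    rw [this]
    exact hrs.comp (Equiv.bijective _)
  have hμt : ∀ a, μ.1 (t a) = r a := fun a => by rw [← hμ, (μ.2 _).1]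
  have hne : ∀ a b, r a ≠ t b := fun a b h => by
    simpa using hrt.1 (show Sum.elim r t (Sum.inl a) = Sum.elim r t (Sum.inr b) from h)
  have htinj : Function.Injective t := fun a b h =>
    τ.injective (hs.injective (by rw [← ht, ← ht, h]))
  have hcr : (crossings μ : ZMod 2) = ∑ a, ∑ b,
      (crossInd (r a) (t a) (r b) (t b) + crossInd (r a) (t a) (t b) (r b) +
        crossInd (t a) (r a) (r b) (t b) + crossInd (t a) (r a) (t b) (r b)) := by
    have h0 : (crossings μ : ZMod 2) = ∑ i, ∑ j, crossInd i (μ.1 i) j (μ.1 j) := by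
      rw [crossings, Finset.natCast_card_filter, Fintype.sum_prod_type]
      rfl
    rw [h0, sum_eq_sum_sources_add_targets hrt]
    refine Finset.sum_congr rfl fun a _ => ?_
    rw [sum_eq_sum_sources_add_targets hrt, sum_eq_sum_sources_add_targets hrt, ← Finset.sum_add_distrib]
    refine Finset.sum_congr rfl fun b _ => ?_
    rw [hμ, hμt, hμ, hμt]
    ring
  -- A point, counted from `0`, is the number of sources and targets to its left.
  have hsum : ∀ a, ((r a : ℕ) : ZMod 2) =
      ∑ b, ((if r b < r a then 1 else 0) + if t b < r a then 1 else 0) := by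
    intro a
    rw [← sum_eq_sum_sources_add_targets hrt (fun i => if i < r a then (1 : ZMod 2) else 0),
      ← Finset.natCast_card_filter, Finset.filter_gt_eq_Iio, Fin.card_Iio]
  have hinv : ((∑ a, ∑ b, if a < b ∧ τ b < τ a then 1 else 0 : ℕ) : ZMod 2) =
      ∑ a, ∑ b, if r a < r b ∧ t b < t a then 1 else 0 := by
    push_cast
    simp only [ht, hr.lt_iff_lt, hs.lt_iff_lt]
  have hdiag : ((#{a | μ.1 (r a) < r a} : ℕ) : ZMod 2) =
      ∑ a, ∑ b, if a = b then (if t a < r a then 1 else 0) else 0 := by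
    rw [Finset.natCast_card_filter]
    simp [hμ]
  -- Move everything to one side; in characteristic two, interchanging the two chords is then an
  -- involution that cancels the terms of the double sum.
  rw [← sub_eq_zero, Nat.cast_add, Nat.cast_add, hinv, hcr, hdiag, Nat.cast_sum]
  simp only [hsum, CharTwo.sub_eq_add, ← Finset.sum_add_distrib]
  rw [← Fintype.sum_prod_type']
  refine Finset.sum_involution (fun x _ => x.swap) ?_ ?_ (by simp) (by simp)
  · rintro ⟨a, b⟩ -
    by_cases hab : a = b
    · subst hab
      exact CharTwo.add_self_eq_zero _
    · have := chord_parity (hne a a) (hr.injective.ne hab) (hne a b) (hne b a).symm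
        (htinj.ne hab) (hne b b)
      simp only [chordWeight] at this
      simp only [Prod.swap, hab, Ne.symm hab, if_false]
      linear_combination this
  · rintro ⟨a, b⟩ - hF hswap
    simp only [Prod.swap, Prod.mk.injEq] at hswap
    obtain ⟨rfl, -⟩ := hswap
    apply hF
    have h2 : (1 : ZMod 2) + 1 = 0 := CharTwo.add_self_eq_zero 1
    rcases lt_or_gt_of_ne (hne b b) with h | h
    · simp [crossInd, h, h.not_gt]
    · simp [crossInd, h, h.not_gt, h2]

/-- Let the pairs of a matching be oriented as `r a → s (τ a)`, with `r` and `s` increasing. The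
sign of the matching, corrected by a sign for each pair oriented to the left, is the sign of `τ` up
to the parity of the sum of the sources. -/
theorem crossings_sign {A : Type*} [CommRing A] (μ : PerfectMatching m) (τ : Equiv.Perm (Fin p))
    {r s : Fin p → Fin m} (hr : StrictMono r) (hs : StrictMono s)
    (hrs : Function.Bijective (Sum.elim r s)) (hμ : ∀ a, μ.1 (r a) = s (τ a)) :
    (-1 : A) ^ crossings μ * (-1) ^ #{a | μ.1 (r a) < r a} =
      (-1) ^ (∑ a, (r a : ℕ)) * (Equiv.Perm.sign τ : ℤ) := by
  have h := crossings_parity μ τ hr hs hrs (fun _ => rfl) hμ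
  rw [ZMod.natCast_eq_natCast_iff'] at h
  rw [sign_eq_neg_one_pow_inversions]
  push_cast
  rw [← pow_add, ← pow_add, neg_one_pow_eq_pow_mod_two, h, ← neg_one_pow_eq_pow_mod_two]

end Signs

/-! ### The Pfaffian of `B - Bᵀ` -/

section Pfaffian

variable {A : Type*} [CommRing A] {m p : ℕ}

/-- `R` contains exactly one point of every pair of the matching `μ`. Such sets are the possible
sets of sources when the pairs of `μ` are oriented. -/
def IsTransversal (μ : PerfectMatching m) (R : Finset (Fin m)) : Prop :=
  ∀ i, μ.1 i ∈ R ↔ i ∉ R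

instance (μ : PerfectMatching m) (R : Finset (Fin m)) : Decidable (IsTransversal μ R) := by
  unfold IsTransversal
  infer_instance

theorem IsTransversal.card_add_card {μ : PerfectMatching m} {R : Finset (Fin m)}
    (h : IsTransversal μ R) : #R + #R = m := by
  have : R.map μ.1.toEmbedding = Rᶜ := by
    ext i
    rw [mem_compl, ← h i, mem_map_equiv]
    have : μ.1.symm i = μ.1 i := by rw [Equiv.symm_apply_eq, (μ.2 i).1]
    rw [this]
  have hc := card_compl R
  rw [← this, card_map, Fintype.card_fin] at hc
  have := card_le_univ R
  rw [Fintype.card_fin] at this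
  omega

/-- Expanding the product chooses an orientation `i → μ i` or `μ i → i` of every pair; the
transversal `R` is the set of sources. -/
theorem prod_sub_eq_sum_transversal (μ : PerfectMatching m) (B : Matrix (Fin m) (Fin m) A) :
    ∏ i with i < μ.1 i, (B i (μ.1 i) - B (μ.1 i) i) =
      ∑ R with IsTransversal μ R, (-1) ^ #{i ∈ R | μ.1 i < i} * ∏ i ∈ R, B i (μ.1 i) := by
  have hinv : ∀ i, μ.1 (μ.1 i) = i := fun i => (μ.2 i).1
  have hne : ∀ i, μ.1 i ≠ i := fun i => (μ.2 i).2
  have hlt : ∀ i, ¬ i < μ.1 i ↔ μ.1 i < i := fun i =>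
    ⟨fun h => lt_of_le_of_ne (not_lt.1 h) (hne i), fun h => h.not_gt⟩
  simp only [sub_eq_add_neg]
  rw [Finset.prod_add]
  -- `T` consists of the left endpoints of the pairs that are oriented to the right.
  refine Finset.sum_bij' (fun T _ => ({i | if i < μ.1 i then i ∈ T else μ.1 i ∉ T} : Finset (Fin m)))
    (fun R _ => {i ∈ R | i < μ.1 i}) ?_ ?_ ?_ ?_ ?_
  · intro T _
    refine mem_filter.2 ⟨mem_univ _, fun i => ?_⟩
    simp only [mem_filter, mem_univ, true_and, hinv]
    rcases lt_or_gt_of_ne (hne i) with h | h <;> simp [h, h.not_gt]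
  · intro R _
    simp only [mem_powerset]
    exact fun i hi => by simpa using (mem_filter.1 hi).2
  · intro T hT
    ext i
    have : i ∈ T → i < μ.1 i := fun hi => by simpa using mem_powerset.1 hT hi
    simp only [mem_filter, mem_univ, true_and]
    constructor
    · rintro ⟨h1, h2⟩
      simpa [h2] using h1
    · intro h
      simp [h, this h]
  · intro R hR
    have hR : IsTransversal μ R := by simpa using hR
    ext i
    simp only [mem_filter, mem_univ, true_and, hinv]
    by_cases h : i < μ.1 i
    · simp [h]
    · have := hR i
      simp only [h, if_false, (hlt i).1 h, and_true]
      tauto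
  · intro T hT
    have hTlt : ∀ i, i ∈ T → i < μ.1 i := fun i hi => by simpa using mem_powerset.1 hT hi
    set R : Finset (Fin m) := {i | if i < μ.1 i then i ∈ T else μ.1 i ∉ T} with hRdef
    have hT' : ({i ∈ R | i < μ.1 i} : Finset (Fin m)) = T := by
      ext i
      simp only [hRdef, mem_filter, mem_univ, true_and]
      constructor
      · rintro ⟨h1, h2⟩
        simpa [h2] using h1
      · intro h
        simp [h, hTlt i h]
    have hneg : ∏ i ∈ ({i | i < μ.1 i} : Finset (Fin m)) \ T, -B (μ.1 i) i =
        ∏ i ∈ R with μ.1 i < i, -B i (μ.1 i) := by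
      refine Finset.prod_bij' (fun i _ => μ.1 i) (fun i _ => μ.1 i) ?_ ?_ ?_ ?_ ?_
      · intro i hi
        simp only [mem_sdiff, mem_filter, mem_univ, true_and] at hi
        simp [hRdef, hinv, hi.1, hi.1.not_gt, hi.2]
      · intro i hi
        simp only [hRdef, mem_filter, mem_univ, true_and] at hi
        have h2 := hi.1
        rw [if_neg hi.2.not_gt] at h2
        simp [hinv, hi.2, h2]
      · exact fun i _ => hinv i
      · exact fun i _ => hinv i
      · intro i _
        rw [hinv]
    rw [hneg, Finset.prod_neg, ← Finset.prod_filter_mul_prod_filter_not R (fun i => i < μ.1 i), hT']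
    simp only [hlt]
    ring

/-- The perfect matching with pairs `{E (inl a), E (inr (τ a))}`. -/
def matchingOfPerm (E : Fin p ⊕ Fin p ≃ Fin m) (τ : Equiv.Perm (Fin p)) : PerfectMatching m :=
  ⟨E.symm.trans (((Equiv.sumComm _ _).trans (Equiv.sumCongr τ.symm τ)).trans E), fun i => by
    obtain ⟨x, rfl⟩ := E.surjective i
    rcases x with a | a <;> simp⟩

theorem matchingOfPerm_inl (E : Fin p ⊕ Fin p ≃ Fin m) (τ : Equiv.Perm (Fin p)) (a : Fin p) :
    (matchingOfPerm E τ).1 (E (Sum.inl a)) = E (Sum.inr (τ a)) := by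
  simp [matchingOfPerm]

theorem matchingOfPerm_inr (E : Fin p ⊕ Fin p ≃ Fin m) (τ : Equiv.Perm (Fin p)) (a : Fin p) :
    (matchingOfPerm E τ).1 (E (Sum.inr a)) = E (Sum.inl (τ.symm a)) := by
  simp [matchingOfPerm]

/-- The matchings with transversal `R` correspond to the bijections from `R` to its complement,
hence to the terms of the minor of `B` with rows `R` and columns `Rᶜ`. -/
theorem sum_matchings_of_transversal (B : Matrix (Fin m) (Fin m) A) {R : Finset (Fin m)}
    (hR : #R = p) (hRc : #Rᶜ = p) :
    ∑ μ : PerfectMatching m with IsTransversal μ R,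
        (-1) ^ crossings μ * ((-1) ^ #{i ∈ R | μ.1 i < i} * ∏ i ∈ R, B i (μ.1 i)) =
      (-1) ^ (∑ i ∈ R, (i : ℕ)) *
        (B.submatrix (R.orderEmbOfFin hR) (Rᶜ.orderEmbOfFin hRc)).det := by
  set r := R.orderEmbOfFin hR with hr
  set s := Rᶜ.orderEmbOfFin hRc with hs
  set E : Fin p ⊕ Fin p ≃ Fin m := finSumEquivOfFinset hR hRc with hE
  have hEl : ∀ a, E (Sum.inl a) = r a := fun a => finSumEquivOfFinset_inl hR hRc a
  have hEr : ∀ a, E (Sum.inr a) = s a := fun a => finSumEquivOfFinset_inr hR hRc a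
  have hEs : Sum.elim r s = E := by
    ext x
    rcases x with a | a
    · rw [hEl]; rfl
    · rw [hEr]; rfl
  have hrR : ∀ a, r a ∈ R := fun a => orderEmbOfFin_mem R hR a
  have hsR : ∀ a, s a ∉ R := fun a => mem_compl.1 (orderEmbOfFin_mem Rᶜ hRc a)
  have hmap : R = univ.map r.toEmbedding := (map_orderEmbOfFin_univ R hR).symm
  rw [← Matrix.det_transpose, Matrix.det_apply', Finset.mul_sum]
  symm
  refine Finset.sum_bij (fun τ _ => matchingOfPerm E τ) ?_ ?_ ?_ ?_
  · intro τ _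
    simp only [mem_filter, mem_univ, true_and]
    intro i
    obtain ⟨x, rfl⟩ := E.surjective i
    rcases x with a | a
    · rw [matchingOfPerm_inl, hEl, hEr]
      simp [hrR, hsR]
    · rw [matchingOfPerm_inr, hEl, hEr]
      simp [hrR, hsR]
  · intro τ _ υ _ h
    ext a
    have := matchingOfPerm_inl E τ a
    rw [h, matchingOfPerm_inl] at this
    rw [Sum.inr_injective (E.injective this)]
  · intro μ hμ
    have hμ : IsTransversal μ R := by simpa using hμ
    obtain ⟨τ, hτ⟩ := exists_perm_orderEmbOfFin Rᶜ hRc (f := fun a => μ.1 (r a))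
      (μ.1.injective.comp r.injective)
      (fun a => mem_compl.2 fun h => (hμ _).1 h (hrR a))
    refine ⟨τ, mem_univ _, Subtype.ext (Equiv.ext fun i => ?_)⟩
    obtain ⟨x, rfl⟩ := E.surjective i
    rcases x with a | a
    · rw [matchingOfPerm_inl, hEl, hEr]
      exact (hτ a).symm
    · rw [matchingOfPerm_inr, hEl, hEr]
      have := hτ (τ.symm a)
      rw [τ.apply_symm_apply] at this
      rw [← hs] at this
      rw [← this, (μ.2 _).1]
  · intro τ _
    have hμ : ∀ a, (matchingOfPerm E τ).1 (r a) = s (τ a) := fun a => by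
      rw [← hEl, matchingOfPerm_inl, hEr]
    have hsign := crossings_sign (A := A) (matchingOfPerm E τ) τ r.strictMono s.strictMono
      (hEs ▸ E.bijective) hμ
    have h1 : ∑ i ∈ R, (i : ℕ) = ∑ a, (r a : ℕ) := by
      conv_lhs => rw [hmap]
      rw [Finset.sum_map]; rfl
    have h2 : ∏ i ∈ R, B i ((matchingOfPerm E τ).1 i) = ∏ a, B (r a) (s (τ a)) := by
      conv_lhs => rw [hmap]
      rw [Finset.prod_map]
      exact Finset.prod_congr rfl fun a _ => by rw [← hμ]; rfl
    have h3 : #{i ∈ R | (matchingOfPerm E τ).1 i < i} =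
        #{a | (matchingOfPerm E τ).1 (r a) < r a} := by
      conv_lhs => rw [hmap]
      rw [Finset.filter_map, card_map]; rfl
    rw [h1, h2, h3, ← mul_assoc, ← mul_assoc, hsign]
    rfl

/-- The Pfaffian of `B - Bᵀ` as a signed sum of the minors of `B` with complementary rows and
columns. -/
theorem pfaffian_sub_transpose (B : Matrix (Fin m) (Fin m) A) (hm : p + p = m) :
    pfaffian (B - B.transpose) =
      ∑ R : SubsetOfCard m p, ∑ S : SubsetOfCard m p with R.1 ∪ S.1 = univ,
        (-1) ^ (∑ r ∈ R.1, (r : ℕ)) *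
          (B.submatrix (R.1.orderEmbOfFin R.2) (S.1.orderEmbOfFin S.2)).det := by
  have hcompl : ∀ R : Finset (Fin m), #R = p → #Rᶜ = p := fun R hR => by
    rw [card_compl, Fintype.card_fin]; omega
  have h1 : pfaffian (B - B.transpose) =
      ∑ R : Finset (Fin m), ∑ μ : PerfectMatching m with IsTransversal μ R,
        (-1) ^ crossings μ * ((-1) ^ #{i ∈ R | μ.1 i < i} * ∏ i ∈ R, B i (μ.1 i)) := by
    simp only [pfaffian, Matrix.sub_apply, Matrix.transpose_apply, prod_sub_eq_sum_transversal,
      Finset.mul_sum]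
    exact Finset.sum_comm' (by simp)
  have hcard : ∀ R : Finset (Fin m), R ∈ univ →
      ∑ μ : PerfectMatching m with IsTransversal μ R,
        (-1 : A) ^ crossings μ * ((-1) ^ #{i ∈ R | μ.1 i < i} * ∏ i ∈ R, B i (μ.1 i)) ≠ 0 →
      #R = p := by
    intro R _ hne
    obtain ⟨μ, hμ, -⟩ := Finset.exists_ne_zero_of_sum_ne_zero hne
    have := (mem_filter.1 hμ).2.card_add_card
    omega
  rw [h1, ← Finset.sum_filter_of_ne hcard,
    Finset.sum_subtype (p := fun R => #R = p) _ (by simp)]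
  refine Finset.sum_congr rfl fun R _ => ?_
  rw [sum_matchings_of_transversal B R.2 (hcompl R.1 R.2)]
  have : ({S | R.1 ∪ S.1 = univ} : Finset (SubsetOfCard m p)) = {⟨R.1ᶜ, hcompl R.1 R.2⟩} := by
    ext S
    simp only [mem_filter, mem_univ, true_and, mem_singleton]
    constructor
    · intro h
      refine Subtype.ext (Finset.eq_of_subset_of_card_le ?_ ?_).symm
      · intro i hi
        have := mem_union.1 (h ▸ mem_univ i)
        exact this.resolve_left (mem_compl.1 hi)
      · rw [hcompl R.1 R.2, S.2]
    · rintro rfl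
      exact union_compl R.1
  rw [this, Finset.sum_singleton]

end Pfaffian

/-! ### Skew Schur functions as minors -/

section Schur

variable {n p : ℕ}

theorem lam_parts_eq (I : SubsetOfCard n p) (k : Fin p) :
    ((lam I).parts k : ℤ) = (I.1.orderEmbOfFin I.2 k.rev : ℕ) - (p - 1 - (k : ℕ)) := by
  have h := (monotone_sub I).1 k.rev
  have hk := k.isLt
  have hv := Fin.val_rev k
  simp only [lam]
  omega

theorem isHorizontalStrip_lam_iff (I J : SubsetOfCard n p) :
    IsHorizontalStrip (lam J) (lam I) ↔
      (∀ k, I.1.orderEmbOfFin I.2 k ≤ J.1.orderEmbOfFin J.2 k) ∧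
        ∀ k l : Fin p, (k : ℕ) + 1 = l → J.1.orderEmbOfFin J.2 k < I.1.orderEmbOfFin I.2 l := by
  constructor
  · rintro ⟨h1, h2⟩
    refine ⟨fun k => ?_, fun k l hkl => ?_⟩
    · have := h1 k.rev
      have hI := lam_parts_eq I k.rev
      have hJ := lam_parts_eq J k.rev
      rw [Fin.rev_rev] at hI hJ
      rw [Fin.le_def]
      omega
    · have hk := k.isLt
      have hl := l.isLt
      have := h2 l.rev k.rev (by rw [Fin.val_rev, Fin.val_rev]; omega)
      have hI := lam_parts_eq I l.rev
      have hJ := lam_parts_eq J k.rev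
      rw [Fin.rev_rev, Fin.val_rev] at hI hJ
      rw [Fin.lt_def]
      omega
  · rintro ⟨h1, h2⟩
    refine ⟨fun k => ?_, fun k l hkl => ?_⟩
    · have := Fin.le_def.1 (h1 k.rev)
      have hI := lam_parts_eq I k
      have hJ := lam_parts_eq J k
      omega
    · have hk := k.isLt
      have hl := l.isLt
      have := Fin.lt_def.1 (h2 l.rev k.rev (by rw [Fin.val_rev, Fin.val_rev]; omega))
      have hI := lam_parts_eq I k
      have hJ := lam_parts_eq J l
      omega

/-- The matrix `(h_{k - i})` of complete homogeneous symmetric functions, with rows `i` and columns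
`k`. -/
noncomputable def homogMatrix (K : Type*) [CommRing K] {σ : Type*} (x : ℕ ↪ σ) (m n : ℕ) :
    Matrix (Fin m) (Fin n) (MvPowerSeries σ K) :=
  Matrix.of fun i k => completeHomog K x (((k : ℕ) : ℤ) - ((i : ℕ) : ℤ))

/-- As `λ(I)_k - k` is an element of `I` up to a constant, with `I` read from the right, the matrix
defining the skew Schur function is a submatrix of `(h_{k - i})` turned by 180 degrees. -/
theorem skewSchur_lam_eq_det {m : ℕ} (K : Type*) [CommRing K] {σ : Type*} (x : ℕ ↪ σ)
    (I : SubsetOfCard n p) (R : SubsetOfCard m p) :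
    skewSchur K x (lam I) (lam R) =
      ((homogMatrix K x m n).submatrix (R.1.orderEmbOfFin R.2) (I.1.orderEmbOfFin I.2)).det := by
  rw [skewSchur, ← Matrix.det_submatrix_equiv_self Fin.revPerm (Matrix.submatrix _ _ _)]
  congr 1
  ext1 i j
  simp only [Matrix.of_apply, Matrix.submatrix_apply, homogMatrix, Fin.revPerm_apply,
    lam_parts_eq]
  congr 1
  ring

theorem det_mul_le_indicator_mul {A : Type*} [CommRing A] {m : ℕ}
    (X Y : Matrix (Fin m) (Fin n) A) (r s : Fin p → Fin m) :
    ((X * (Matrix.of fun k l : Fin n => if k ≤ l then (1 : A) else 0) *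
        Y.transpose).submatrix r s).det =
      ∑ I : SubsetOfCard n p, ∑ J : SubsetOfCard n p with IsHorizontalStrip (lam J) (lam I),
        (X.submatrix r (I.1.orderEmbOfFin I.2)).det *
          (Y.submatrix s (J.1.orderEmbOfFin J.2)).det := by
  set T : Matrix (Fin n) (Fin n) A := Matrix.of fun k l : Fin n => if k ≤ l then (1 : A) else 0
    with hT
  have h1 : (X * T * Y.transpose).submatrix r s =
      X.submatrix r id * (T * Y.transpose.submatrix id s) := by
    rw [Matrix.mul_assoc]
    rfl
  rw [h1, det_mul_eq_sum_minors]
  refine Finset.sum_congr rfl fun I _ => ?_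
  have h2 : (T * Y.transpose.submatrix id s).submatrix (I.1.orderEmbOfFin I.2) id =
      T.submatrix (I.1.orderEmbOfFin I.2) id * Y.transpose.submatrix id s := rfl
  rw [h2, det_mul_eq_sum_minors, Finset.mul_sum, Finset.sum_filter]
  refine Finset.sum_congr rfl fun J _ => ?_
  have h3 := det_le_indicator_eq (A := A) (I.1.orderEmbOfFin I.2).strictMono
    (J.1.orderEmbOfFin J.2).strictMono
  have h4 : (T.submatrix (I.1.orderEmbOfFin I.2) id).submatrix id (J.1.orderEmbOfFin J.2) =
      Matrix.of fun a b =>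
        if I.1.orderEmbOfFin I.2 a ≤ J.1.orderEmbOfFin J.2 b then (1 : A) else 0 := rfl
  have h5 : ((Y.transpose.submatrix id s).submatrix (J.1.orderEmbOfFin J.2) id).det =
      (Y.submatrix s (J.1.orderEmbOfFin J.2)).det := by
    rw [← Matrix.det_transpose]
    rfl
  rw [h4, h3, h5, Matrix.submatrix_submatrix]
  simp only [isHorizontalStrip_lam_iff, Function.id_comp, Function.comp_id]
  split_ifs <;> simp

end Schur

end SkewCauchy

open SkewCauchy in
/-- The identity holds in the ring of formal power series in the variables `x` and `y`.
As `[m]` and `[n]` are represented by `Fin m` and `Fin n`, the sign exponent `r - 1` is the value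
of `r : Fin m`, and differences such as `k - i` are those of the values. -/
theorem theorem5p8 (K : Type*) [CommRing K] (m n : ℕ) (hm : 0 < m) (hn : 0 < n)
    (hm_even : Even m) :
    (∑ R : SubsetOfCard m (m / 2), ∑ S : SubsetOfCard m (m / 2) with R.1 ∪ S.1 = Finset.univ,
      (-1 : MvPowerSeries (ℕ ⊕ ℕ) K) ^ (∑ r ∈ R.1, (r : ℕ)) *
        ∑ I : SubsetOfCard n (m / 2),
          ∑ J : SubsetOfCard n (m / 2) with IsHorizontalStrip (lam J) (lam I),
            skewSchur K xVars (lam I) (lam R) * skewSchur K yVars (lam J) (lam S)) =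
      pfaffian (Matrix.of fun i j : Fin m =>
        ∑ k : Fin n, ∑ l : Fin n with k ≤ l,
          (completeHomog K xVars (((k : ℕ) : ℤ) - ((i : ℕ) : ℤ)) *
              completeHomog K yVars (((l : ℕ) : ℤ) - ((j : ℕ) : ℤ)) -
            completeHomog K yVars (((l : ℕ) : ℤ) - ((i : ℕ) : ℤ)) *
              completeHomog K xVars (((k : ℕ) : ℤ) - ((j : ℕ) : ℤ)))) := by
  have hp : m / 2 + m / 2 = m := by
    obtain ⟨q, rfl⟩ := hm_even
    omega
  set X := homogMatrix K xVars m n with hX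
  set Y := homogMatrix K yVars m n with hY
  set T : Matrix (Fin n) (Fin n) (MvPowerSeries (ℕ ⊕ ℕ) K) :=
    Matrix.of fun k l : Fin n => if k ≤ l then 1 else 0 with hT
  have hB : (Matrix.of fun i j : Fin m =>
        ∑ k : Fin n, ∑ l : Fin n with k ≤ l,
          (completeHomog K xVars (((k : ℕ) : ℤ) - ((i : ℕ) : ℤ)) *
              completeHomog K yVars (((l : ℕ) : ℤ) - ((j : ℕ) : ℤ)) -
            completeHomog K yVars (((l : ℕ) : ℤ) - ((i : ℕ) : ℤ)) *
              completeHomog K xVars (((k : ℕ) : ℤ) - ((j : ℕ) : ℤ)))) =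
      X * T * Y.transpose - (X * T * Y.transpose).transpose := by
    have hent : ∀ i j, (X * T * Y.transpose) i j = ∑ k, ∑ l with k ≤ l, X i k * Y j l := by
      intro i j
      simp only [Matrix.mul_apply, Matrix.transpose_apply, Finset.sum_mul, Finset.sum_filter]
      rw [Finset.sum_comm]
      simp [hT]
    ext1 i j
    rw [Matrix.sub_apply, Matrix.transpose_apply, hent, hent]
    simp only [← Finset.sum_sub_distrib, hX, hY, homogMatrix, Matrix.of_apply]
    refine Finset.sum_congr rfl fun k _ => Finset.sum_congr rfl fun l _ => ?_
    ring
  rw [hB, pfaffian_sub_transpose _ hp]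
  refine Finset.sum_congr rfl fun R _ => Finset.sum_congr rfl fun S _ => ?_
  simp only [skewSchur_lam_eq_det]
  rw [det_mul_le_indicator_mul]
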